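/- A \emph{probabilistic finite automaton} (PFA) with $d$ states over a finite alphabet $\Sigma$ is given by a probability distribution $\pi\in\mathbb{Q}^d$ (the starting distribution), a $d\times d$ row-stochastic matrix $M_\sigma$ with rational entries for each letter $\sigma\in\Sigma$, and a $0$-$1$-vector $f\in\{0,1\}^d$ (the characteristic vector of the set of accepting states). The acceptance probability of a word $\sigma_1\sigma_2\cdots\sigma_m\in\Sigma^*$ is $\pi^T M_{\sigma_1}M_{\sigma_2}\cdots M_{\sigma_m} f$ (for the empty word, $m=0$, it is $\pi^T f$). The language recognized by the PFA with cutpoint $\lambda$ is the set of all words in $\Sigma^*$ whose acceptance probability is strictly greater than $\lambda$. \textbf{Proposition.} The following problem is algorithmically undecidable: given a PFA with $12$ states (that is, given $\Sigma$, $\pi$, the matrices $M_\sigma$ for $\sigma\in\Sigma$, and $f$, where probabilities are written as fractions of natural numbers), is the language recognized by it with cutpoint $\lambda=\frac14$ empty? -/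

import Mathlib

open Matrix

/-- A probabilistic finite automaton with rational data, state set `Q` and input alphabet `α`. -/
structure PFA (Q α : Type) [Fintype Q] [DecidableEq Q] where
  /-- the starting distribution `π` -/
  start : Q → ℚ
  /-- the transition matrix `M_a` of each letter `a` -/
  trans : α → Matrix Q Q ℚ
  /-- the characteristic function of the set of accepting states -/
  accept : Q → Bool
  start_mem : start ∈ stdSimplex ℚ Q
  trans_mem : ∀ a, trans a ∈ Matrix.rowStochastic ℚ Q

namespace PFA

section

variable {Q α : Type} [Fintype Q] [DecidableEq Q]

/-- The 0-1-vector of accepting states. -/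
def acceptVec (A : PFA Q α) : Q → ℚ := fun q => if A.accept q then 1 else 0

/-- The acceptance probability `πᵀ M_{a₁} M_{a₂} ⋯ M_{aₘ} f` of the word `a₁ a₂ … aₘ`. -/
def acceptProb (A : PFA Q α) (w : List α) : ℚ :=
  A.start ⬝ᵥ ((w.map A.trans).prod *ᵥ A.acceptVec)

/-- The language recognized with cutpoint `c`: acceptance probability strictly above `c`. -/
def language (A : PFA Q α) (c : ℚ) : Language α := {w | c < A.acceptProb w}

end

/-- The pair `(a, b)` is the fraction `a / b` and has the value `r`. -/
def IsFraction (x : ℕ × ℕ) (r : ℚ) : Prop := x.2 ≠ 0 ∧ (x.1 : ℚ) / (x.2 : ℚ) = r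

/-- The finite data by which a PFA with `d` states is presented to an algorithm: the starting
distribution, the list of the transition matrices (one for each letter), and the 0-1-vector of
accepting states. A probability is written as a pair (numerator, denominator). -/
abbrev Code (d : ℕ) : Type :=
  (Fin d → ℕ × ℕ) × List (Fin d → Fin d → ℕ × ℕ) × (Fin d → Bool)

/-- `c` is a presentation of the PFA `A` with states `0, …, d-1` and letters `0, …, k-1`. -/
structure Represents {d k : ℕ} (c : Code d) (A : PFA (Fin d) (Fin k)) : Prop where
  start : ∀ q, IsFraction (c.1 q) (A.start q)
  length : c.2.1.length = k
  trans : ∀ (a : Fin k) (p q : Fin d),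
    IsFraction ((c.2.1[(a : ℕ)]'(length.symm ▸ a.isLt)) p q) (A.trans a p q)
  accept : c.2.2 = A.accept

/-- Emptiness of the language of a PFA with `d` states and cutpoint `cut` is decidable: some
computable predicate on presentations gives the right answer on every presentation of every
PFA with `d` states over a finite alphabet. Nothing is required on data that present no PFA. -/
def EmptinessDecidable (d : ℕ) (cut : ℚ) : Prop :=
  ∃ P : Code d → Prop, ComputablePred P ∧
    ∀ (k : ℕ) (A : PFA (Fin d) (Fin k)) (c : Code d), Represents c A →
      (P c ↔ ∀ w, w ∉ A.language cut)

end PFA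

/-! Halting is reduced to non-emptiness by an automaton whose input words are proposed computations.
Halting is first expressed as reachability of 0 under one fixed finite list of rules m y + r ↦ a y +
b, where only the starting number depends on the program (`exists_halting_rules`). To this end a
nondeterministic counter machine guesses and checks a halting run, and its registers are stored as
prime exponents.

A word then guesses a derivation. Letters `none` build the parameter y in unary; a rule letter
overwrites x by a y + b and adds (x - m y - r)² to an error e. Seven monomials in x, y, e transform
linearly under every letter (`monomials_vecMul`). Carried as a zero-sum deviation from the uniform
distribution on 12 states, this linear action becomes stochastic at the price of a positive scaling
factor (`distribution_vecMul`). Three accepting states yield acceptance probability 1/4 + δ/12 (1 -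
e - x²) with δ > 0. Since e ≥ 0 and x are integers, this exceeds 1/4 exactly when e = 0 and x = 0,
that is, when the word is a correct derivation of 0 (`exists_mem_language_ofRules`). -/

/-! ### Nondeterministic counter machines -/

namespace CounterMachine

open Relation Function

/-- An instruction of a counter machine. -/
inductive Instr
  | skip
  | inc (i : ℕ)
  | dec (i : ℕ)
  | zero (i : ℕ)

/-- The effect of an instruction on the registers. -/
def Instr.Rel : Instr → (ℕ → ℕ) → (ℕ → ℕ) → Prop
  | skip, v, w => w = v
  | inc i, v, w => w = update v i (v i + 1)
  | dec i, v, w => v i ≠ 0 ∧ w = update v i (v i - 1)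
  | zero i, v, w => v i = 0 ∧ w = v

/-- One step of the counter machine with the list of transitions `E`. -/
def Step {S : Type} (E : List (S × Instr × S)) (c d : S × (ℕ → ℕ)) : Prop :=
  ∃ I : Instr, (c.1, I, d.1) ∈ E ∧ I.Rel c.2 d.2

/-- Relations on register contents computed by a nondeterministic counter machine. -/
def Realizable (R : (ℕ → ℕ) → (ℕ → ℕ) → Prop) : Prop :=
  ∃ (S : Type) (_ : Fintype S) (E : List (S × Instr × S)) (s t : S),
    ∀ v w, R v w ↔ ReflTransGen (Step E) (s, v) (t, w)

theorem Realizable.congr {R R' : (ℕ → ℕ) → (ℕ → ℕ) → Prop} (h : Realizable R)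
    (H : ∀ v w, R' v w ↔ R v w) : Realizable R' := by
  obtain ⟨S, i, E, s, t, h⟩ := h
  exact ⟨S, i, E, s, t, fun v w => (H v w).trans (h v w)⟩

theorem realizable_instr (I : Instr) : Realizable I.Rel := by
  refine ⟨Bool, inferInstance, [(false, I, true)], false, true, fun v w => ⟨fun h => ?_, fun h => ?_⟩⟩
  · exact .single ⟨I, by simp, h⟩
  · have key : ∀ c, ReflTransGen (Step [(false, I, true)]) (false, v) c →
        c = (false, v) ∨ (c.1 = true ∧ I.Rel v c.2) := by
      intro c hc
      induction hc with
      | refl => exact .inl rfl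
      | @tail c d _ h ih =>
        obtain ⟨J, hJ, hr⟩ := h
        simp only [List.mem_singleton, Prod.mk.injEq] at hJ
        obtain ⟨h1, rfl, h2⟩ := hJ
        rcases ih with rfl | ih
        · exact .inr ⟨h2, hr⟩
        · simp [ih.1] at h1
    simpa using key _ h

/-- Moving a transition list along a map of states. -/
def mapEdges {S S' : Type} (f : S → S') (E : List (S × Instr × S)) : List (S' × Instr × S') :=
  E.map fun e => (f e.1, e.2.1, f e.2.2)

theorem mem_mapEdges {S S' : Type} {f : S → S'} {E : List (S × Instr × S)} {p : S'} {I : Instr}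
    {q : S'} : (p, I, q) ∈ mapEdges f E ↔ ∃ a b, (a, I, b) ∈ E ∧ f a = p ∧ f b = q := by
  simp only [mapEdges, List.mem_map, Prod.mk.injEq, Prod.exists]
  constructor
  · rintro ⟨a, J, b, h, rfl, rfl, rfl⟩
    exact ⟨a, b, h, rfl, rfl⟩
  · rintro ⟨a, b, h, rfl, rfl⟩
    exact ⟨a, I, b, h, rfl, rfl, rfl⟩

theorem reach_mapEdges {S S' : Type} {f : S → S'} {E : List (S × Instr × S)}
    {E' : List (S' × Instr × S')} (hE : ∀ e ∈ mapEdges f E, e ∈ E') {p q : S} {v w : ℕ → ℕ}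
    (h : ReflTransGen (Step E) (p, v) (q, w)) :
    ReflTransGen (Step E') (f p, v) (f q, w) := by
  refine ReflTransGen.lift (p := Step E') (fun c : S × (ℕ → ℕ) => (f c.1, c.2)) ?_ _ _ h
  rintro c d ⟨I, hI, hr⟩
  exact ⟨I, hE _ (mem_mapEdges.2 ⟨_, _, hI, rfl, rfl⟩), hr⟩

/-- The two machines are put side by side with one `skip` edge from the first final state to the
second initial state. No edge leads back, so every run splits at its unique crossing. -/
theorem Realizable.comp {R R' : (ℕ → ℕ) → (ℕ → ℕ) → Prop} (h : Realizable R)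
    (h' : Realizable R') : Realizable (Relation.Comp R R') := by
  obtain ⟨S, _, E, s, t, h⟩ := h
  obtain ⟨S', _, E', s', t', h'⟩ := h'
  let F : List ((S ⊕ S') × Instr × (S ⊕ S')) :=
    (Sum.inl t, Instr.skip, Sum.inr s') :: (mapEdges Sum.inl E ++ mapEdges Sum.inr E')
  refine ⟨S ⊕ S', inferInstance, F, Sum.inl s, Sum.inr t', fun v w => ⟨?_, fun hr => ?_⟩⟩
  · rintro ⟨u, h1, h2⟩
    have a1 := reach_mapEdges (f := Sum.inl) (E' := F) (by simp +contextual [F]) ((h _ _).1 h1)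
    have a2 := reach_mapEdges (f := Sum.inr) (E' := F) (by simp +contextual [F]) ((h' _ _).1 h2)
    have a3 : Step F (Sum.inl t, u) (Sum.inr s', u) := ⟨.skip, by simp [F], rfl⟩
    exact (a1.tail a3).trans a2
  · have key : ∀ c, ReflTransGen (Step F) (Sum.inl s, v) c →
        (∃ q, c.1 = Sum.inl q ∧ ReflTransGen (Step E) (s, v) (q, c.2)) ∨
        (∃ q u, c.1 = Sum.inr q ∧ R v u ∧ ReflTransGen (Step E') (s', u) (q, c.2)) := by
      intro c hc
      induction hc with
      | refl => exact .inl ⟨s, rfl, .refl⟩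
      | @tail c d _ hst ih =>
        obtain ⟨c1, c2⟩ := c
        obtain ⟨d1, d2⟩ := d
        obtain ⟨I, hI, hr⟩ := hst
        simp only [F, List.mem_cons, List.mem_append, mem_mapEdges] at hI
        rcases hI with hI | ⟨a, b, hI, h1, h2⟩ | ⟨a, b, hI, h1, h2⟩
        · simp only [Prod.mk.injEq] at hI
          obtain ⟨h1, rfl, h2⟩ := hI
          rcases ih with ⟨q, hq, hr'⟩ | ⟨q, u, hq, _⟩
          · have : t = q := Sum.inl_injective (h1.symm.trans hq)
            subst this
            refine .inr ⟨s', c2, h2, (h _ _).2 hr', ?_⟩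
            have : d2 = c2 := hr
            rw [this]
          · cases h1.symm.trans hq
        · rcases ih with ⟨q, hq, hr'⟩ | ⟨q, u, hq, _⟩
          · have : a = q := Sum.inl_injective (h1.trans hq)
            subst this
            exact .inl ⟨b, h2.symm, hr'.tail ⟨I, hI, hr⟩⟩
          · cases h1.trans hq
        · rcases ih with ⟨q, hq, hr'⟩ | ⟨q, u, hq, hu, hr'⟩
          · cases h1.trans hq
          · have : a = q := Sum.inr_injective (h1.trans hq)
            subst this
            exact .inr ⟨b, u, h2.symm, hu, hr'.tail ⟨I, hI, hr⟩⟩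
    rcases key _ hr with ⟨q, hq, _⟩ | ⟨q, u, hq, hu, hr'⟩
    · simp at hq
    · cases hq
      exact ⟨u, hu, (h' _ _).2 hr'⟩

/-- The fresh state `none` is both initial and final, so each return to it completes exactly one
pass through the machine, even if runs inside the machine revisit `s` or `t`. -/
theorem Realizable.star {R : (ℕ → ℕ) → (ℕ → ℕ) → Prop} (h : Realizable R) :
    Realizable (ReflTransGen R) := by
  obtain ⟨S, _, E, s, t, h⟩ := h
  let F : List (Option S × Instr × Option S) :=
    (none, Instr.skip, some s) :: (some t, Instr.skip, none) :: mapEdges some E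
  refine ⟨Option S, inferInstance, F, none, none, fun v w => ⟨fun hr => ?_, fun hr => ?_⟩⟩
  · induction hr with
    | refl => exact .refl
    | tail _ h1 ih =>
      have a1 := reach_mapEdges (f := some) (E' := F) (by simp +contextual [F]) ((h _ _).1 h1)
      have a2 : ∀ u, Step F (none, u) (some s, u) := fun u => ⟨.skip, by simp [F], rfl⟩
      have a3 : ∀ u, Step F (some t, u) (none, u) := fun u => ⟨.skip, by simp [F], rfl⟩
      exact ((ih.tail (a2 _)).trans a1).tail (a3 _)
  · have key : ∀ c, ReflTransGen (Step F) (none, v) c →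
        (c.1 = none ∧ ReflTransGen R v c.2) ∨
        (∃ q u, c.1 = some q ∧ ReflTransGen R v u ∧ ReflTransGen (Step E) (s, u) (q, c.2)) := by
      intro c hc
      induction hc with
      | refl => exact .inl ⟨rfl, .refl⟩
      | @tail c d _ hst ih =>
        obtain ⟨c1, c2⟩ := c
        obtain ⟨d1, d2⟩ := d
        obtain ⟨I, hI, hr⟩ := hst
        simp only [F, List.mem_cons, mem_mapEdges] at hI
        rcases hI with hI | hI | ⟨a, b, hI, h1, h2⟩
        · simp only [Prod.mk.injEq] at hI
          obtain ⟨h1, rfl, h2⟩ := hI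
          have : d2 = c2 := hr
          subst this
          rcases ih with ⟨hq, hr'⟩ | ⟨q, u, hq, _⟩
          · exact .inr ⟨s, d2, h2, hr', .refl⟩
          · simp [h1] at hq
        · simp only [Prod.mk.injEq] at hI
          obtain ⟨h1, rfl, h2⟩ := hI
          have : d2 = c2 := hr
          subst this
          rcases ih with ⟨hq, hr'⟩ | ⟨q, u, hq, hu, hr'⟩
          · simp [h1] at hq
          · have : t = q := Option.some_injective _ (h1.symm.trans hq)
            subst this
            exact .inl ⟨h2, hu.tail ((h _ _).2 hr')⟩
        · rcases ih with ⟨hq, hr'⟩ | ⟨q, u, hq, hu, hr'⟩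
          · cases h1.trans hq
          · have : a = q := Option.some_injective _ (h1.trans hq)
            subst this
            exact .inr ⟨b, u, h2.symm, hu, hr'.tail ⟨I, hI, hr⟩⟩
    rcases key _ hr with ⟨_, h1⟩ | ⟨q, u, hq, _⟩
    · exact h1
    · simp at hq

/-! ### Basic programs -/

/-- The number of decrements is nondeterministic; the final zero test discards every run that stops
early. -/
theorem realizable_clear (i : ℕ) : Realizable (fun v w => w = update v i 0) := by
  refine ((realizable_instr (.dec i)).star.comp (realizable_instr (.zero i))).congr fun v w => ?_
  constructor
  · rintro rfl
    refine ⟨update v i 0, ?_, by simp [Instr.Rel]⟩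
    generalize hk : v i = k
    induction k generalizing v with
    | zero => rw [← hk, update_eq_self]
    | succ k ih =>
      have := ih (update v i k) (by simp)
      rw [update_idem] at this
      exact .head ⟨by omega, by simp [hk]⟩ this
  · rintro ⟨u, hu, h0, rfl⟩
    have : update w i 0 = update v i 0 := by
      clear h0
      induction hu with
      | refl => rfl
      | tail _ h ih => obtain ⟨_, rfl⟩ := h; rw [update_idem, ih]
    rw [← this, ← h0, update_eq_self]

theorem realizable_guess (i : ℕ) : Realizable (fun v w => ∃ k, w = update v i k) := by
  refine ((realizable_clear i).comp (realizable_instr (.inc i)).star).congr fun v w => ?_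
  constructor
  · rintro ⟨k, rfl⟩
    refine ⟨_, rfl, ?_⟩
    induction k with
    | zero => exact .refl
    | succ k ih => exact ih.tail (by simp [Instr.Rel])
  · rintro ⟨u, rfl, hu⟩
    induction hu with
    | refl => exact ⟨0, rfl⟩
    | tail _ h ih => obtain ⟨k, rfl⟩ := ih; exact ⟨k + 1, by rw [h]; simp⟩

theorem realizable_move {i j : ℕ} (hij : i ≠ j) :
    Realizable (fun v w => w = update (update v j (v i)) i 0) := by
  refine ((realizable_clear j).comp
    ((((realizable_instr (.dec i)).comp (realizable_instr (.inc j))).star).comp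
      (realizable_instr (.zero i)))).congr fun v w => ?_
  constructor
  · rintro rfl
    refine ⟨_, rfl, update (update v j (v i)) i 0, ?_, by simp [Instr.Rel]⟩
    have : ∀ k l, ReflTransGen (Comp (Instr.dec i).Rel (Instr.inc j).Rel)
        (update (update v j l) i k) (update (update v j (l + k)) i 0) := by
      intro k
      induction k with
      | zero => intro l; exact .refl
      | succ k ih =>
        intro l
        refine .head ⟨_, ⟨by simp, rfl⟩, rfl⟩ ?_
        convert ih (l + 1) using 1
        · funext m; simp only [update_apply]; grind
        · funext m; simp only [update_apply]; grind
    convert this (v i) 0 using 1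
    · funext m; simp only [update_apply]; grind
    · simp
  · rintro ⟨_, rfl, u, hu, h0, rfl⟩
    -- The loop preserves the sum of the two registers, so the zero test on `i` fixes the content of
    -- `j`.
    have key : w i + w j = v i ∧ ∀ m, m ≠ i → m ≠ j → w m = v m := by
      clear h0
      induction hu with
      | refl => simp +contextual [hij]
      | tail _ h ih =>
        obtain ⟨_, ⟨h0, rfl⟩, rfl⟩ := h
        simp only [update_apply]
        grind
    funext m
    simp only [update_apply]
    grind

/-! ### Testable predicates, with scratch registers from `b` on -/

/-- Some program tests the property `φ` of the registers below `b` without changing them, provided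
that all registers from `b` on are zero. -/
def Checkable (b : ℕ) (φ : (ℕ → ℕ) → Prop) : Prop :=
  ∃ R, Realizable R ∧ ∀ v : ℕ → ℕ, (∀ j, b ≤ j → v j = 0) → ∀ w, R v w ↔ w = v ∧ φ v

namespace Checkable

theorem congr {b : ℕ} {φ ψ : (ℕ → ℕ) → Prop} (h : Checkable b φ)
    (H : ∀ v, (∀ j, b ≤ j → v j = 0) → (ψ v ↔ φ v)) : Checkable b ψ := by
  obtain ⟨R, hR, h⟩ := h
  exact ⟨R, hR, fun v hv w => by rw [h v hv w, H v hv]⟩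

theorem and {b : ℕ} {φ ψ : (ℕ → ℕ) → Prop} (h : Checkable b φ) (h' : Checkable b ψ) :
    Checkable b (fun v => φ v ∧ ψ v) := by
  obtain ⟨R, hR, h⟩ := h
  obtain ⟨R', hR', h'⟩ := h'
  refine ⟨_, hR.comp hR', fun v hv w => ⟨?_, ?_⟩⟩
  · rintro ⟨u, h1, h2⟩
    obtain ⟨rfl, h1⟩ := (h v hv u).1 h1
    obtain ⟨rfl, h2⟩ := (h' u hv w).1 h2
    exact ⟨rfl, h1, h2⟩
  · rintro ⟨rfl, h1, h2⟩
    exact ⟨w, (h w hv w).2 ⟨rfl, h1⟩, (h' w hv w).2 ⟨rfl, h2⟩⟩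

theorem true (b : ℕ) : Checkable b (fun _ => True) :=
  ⟨_, realizable_instr .skip, fun v _ w => by simp [Instr.Rel]⟩

theorem zero (b i : ℕ) : Checkable b (fun v => v i = 0) :=
  ⟨_, realizable_instr (.zero i), fun v _ w => by simp [Instr.Rel, and_comm]⟩

/-- Nondeterminism supplies the quantifier: a witness is guessed in the scratch register `b`,
tested, and cleared again. -/
theorem ex {b : ℕ} {φ : (ℕ → ℕ) → Prop} (h : Checkable (b + 1) φ) :
    Checkable b (fun v => ∃ k, φ (update v b k)) := by
  obtain ⟨R, hR, h⟩ := h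
  refine ⟨_, (realizable_guess b).comp (hR.comp (realizable_clear b)), fun v hv w => ?_⟩
  have hz : ∀ k j, b + 1 ≤ j → update v b k j = 0 := fun k j hj => by
    rw [update_of_ne (by omega)]; exact hv j (by omega)
  have hb : ∀ k, update (update v b k) b 0 = v := fun k => by
    rw [update_idem, ← hv b le_rfl, update_eq_self]
  constructor
  · rintro ⟨_, ⟨k, rfl⟩, u, h1, rfl⟩
    obtain ⟨rfl, hk⟩ := (h _ (hz k) u).1 h1
    exact ⟨hb k, k, hk⟩
  · rintro ⟨rfl, k, hk⟩
    exact ⟨_, ⟨k, rfl⟩, _, (h _ (hz k) _).2 ⟨rfl, hk⟩, (hb k).symm⟩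

theorem exists_registers {b : ℕ} {φ : (ℕ → ℕ) → Prop} (n : ℕ) (h : Checkable (b + n) φ) :
    Checkable b (fun v => ∃ w : ℕ → ℕ, (∀ j < b, w j = v j) ∧ (∀ j, b + n ≤ j → w j = 0) ∧ φ w) := by
  induction n generalizing b with
  | zero =>
    refine h.congr fun v hv => ⟨?_, fun hφ => ⟨v, fun _ _ => rfl, hv, hφ⟩⟩
    rintro ⟨w, h1, h2, h3⟩
    have : w = v := by
      funext j
      rcases lt_or_ge j b with hj | hj
      · exact h1 j hj
      · rw [hv j hj, h2 j hj]
    rwa [← this]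
  | succ n ih =>
    have := (ih (b := b + 1) (by rwa [Nat.add_right_comm])).ex
    refine this.congr fun v hv => ⟨?_, ?_⟩
    · rintro ⟨w, h1, h2, h3⟩
      refine ⟨w b, w, fun j hj => ?_, fun j hj => h2 j (by omega), h3⟩
      rcases eq_or_ne j b with rfl | hne
      · simp
      · rw [update_of_ne hne]; exact h1 j (by omega)
    · rintro ⟨k, w, h1, h2, h3⟩
      refine ⟨w, fun j hj => ?_, fun j hj => h2 j (by omega), h3⟩
      rw [h1 j (by omega), update_of_ne (by omega)]

theorem forall_fin {b n : ℕ} {φ : Fin n → (ℕ → ℕ) → Prop} (h : ∀ i, Checkable b (φ i)) :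
    Checkable b (fun v => ∀ i, φ i v) := by
  induction n with
  | zero => exact (true b).congr fun v _ => by simp
  | succ n ih =>
    exact ((h 0).and (ih fun i => h i.succ)).congr fun v _ => Fin.forall_fin_succ

/-- Both registers are counted down together while the scratch register `b` counts up. If both reach
zero simultaneously they were equal, and `b` is used to restore them. -/
theorem eq {b i j : ℕ} (hi : i < b) (hj : j < b) : Checkable b (fun v => v i = v j) := by
  -- For `i = j` the joint countdown would decrement the same register twice per round.
  rcases eq_or_ne i j with rfl | hij
  · exact (true b).congr fun v _ => by simp
  have H := (realizable_instr (.dec i)).comp ((realizable_instr (.dec j)).comp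
    (realizable_instr (.inc b)))
  have H' := (realizable_instr (.dec b)).comp ((realizable_instr (.inc i)).comp
    (realizable_instr (.inc j)))
  refine ⟨_, H.star.comp ((realizable_instr (.zero i)).comp ((realizable_instr (.zero j)).comp
    (H'.star.comp (realizable_instr (.zero b))))), fun v hv w => ⟨?_, ?_⟩⟩
  · rintro ⟨_, h1, _, ⟨ui, rfl⟩, u, ⟨uj, rfl⟩, _, h2, wb, rfl⟩
    have k1 : u i + u b = v i + v b ∧ u j + u b = v j + v b ∧
        ∀ m, m ≠ i → m ≠ j → m ≠ b → u m = v m := by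
      clear ui uj h2
      induction h1 with
      | refl => simp
      | tail _ h ih =>
        obtain ⟨_, ⟨h0, rfl⟩, _, ⟨h1, rfl⟩, rfl⟩ := h
        simp only [update_apply] at *
        grind
    have k2 : w i + w b = u i + u b ∧ w j + w b = u j + u b ∧
        ∀ m, m ≠ i → m ≠ j → m ≠ b → w m = u m := by
      clear wb ui uj h1 k1
      induction h2 with
      | refl => simp
      | tail _ h ih =>
        obtain ⟨_, ⟨h0, rfl⟩, _, rfl, rfl⟩ := h
        simp only [update_apply] at *
        grind
    have hb := hv b le_rfl
    exact ⟨funext fun m => by grind, by omega⟩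
  · rintro ⟨rfl, hw⟩
    -- Memory during the transfer: `k` units left in both registers, `l` in the scratch register.
    let V : ℕ → ℕ → ℕ → ℕ := fun k l => update (update (update w i k) j k) b l
    have hV : V (w i) 0 = w := by
      funext m
      have hb := hv b le_rfl
      simp only [V, update_apply]
      grind
    have k1 : ∀ k l, ReflTransGen (Comp (Instr.dec i).Rel (Comp (Instr.dec j).Rel
        (Instr.inc b).Rel)) (V k l) (V 0 (l + k)) := by
      intro k
      induction k with
      | zero => intro l; exact .refl
      | succ k ih =>
        intro l
        refine .head ⟨_, ⟨?_, rfl⟩, _, ⟨?_, rfl⟩, rfl⟩ ?_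
        · simp only [V, update_apply]; grind
        · simp only [V, update_apply]; grind
        · convert ih (l + 1) using 1
          · funext m; simp only [V, update_apply]; grind
          · rw [Nat.add_right_comm, add_assoc]
    have k2 : ∀ l k, ReflTransGen (Comp (Instr.dec b).Rel (Comp (Instr.inc i).Rel
        (Instr.inc j).Rel)) (V k l) (V (k + l) 0) := by
      intro l
      induction l with
      | zero => intro k; exact .refl
      | succ l ih =>
        intro k
        refine .head ⟨_, ⟨?_, rfl⟩, _, rfl, rfl⟩ ?_
        · simp only [V, update_apply]; grind
        · convert ih (k + 1) using 1
          · funext m; simp only [V, update_apply]; grind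
          · rw [Nat.add_right_comm, add_assoc]
    have a1 := k1 (w i) 0
    have a2 := k2 (w i) 0
    rw [hV, zero_add] at a1
    rw [zero_add, hV] at a2
    exact ⟨_, a1, _, ⟨by simp only [V, update_apply]; grind, rfl⟩, _,
      ⟨by simp only [V, update_apply]; grind, rfl⟩, _, a2, hv b le_rfl, rfl⟩

theorem eq_succ {b i j : ℕ} (hi : i < b) (hj : j < b) :
    Checkable b (fun v => v i = v j + 1) := by
  obtain ⟨R, hR, h⟩ := eq (b := b + 1) (i := b) (j := i) (by omega) (by omega)
  obtain ⟨R', hR', h'⟩ := eq (b := b + 1) (i := b) (j := j) (by omega) (by omega)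
  refine ⟨_, (realizable_guess b).comp (hR'.comp ((realizable_instr (.inc b)).comp
    (hR.comp (realizable_clear b)))), fun v hv w => ?_⟩
  have hz : ∀ k l, b + 1 ≤ l → update v b k l = 0 := fun k l hl => by
    rw [update_of_ne (by omega)]; exact hv l (by omega)
  have hb : ∀ k, update (update v b k) b 0 = v := fun k => by
    rw [update_idem, ← hv b le_rfl, update_eq_self]
  constructor
  · rintro ⟨_, ⟨k, rfl⟩, u, h1, _, rfl, u', h2, rfl⟩
    obtain ⟨rfl, e1⟩ := (h' _ (hz k) u).1 h1
    simp only [update_self, update_idem] at h2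
    obtain ⟨rfl, e2⟩ := (h _ (hz _) u').1 h2
    rw [update_self, update_of_ne (by omega)] at e1 e2
    exact ⟨hb _, by dsimp only; omega⟩
  · rintro ⟨rfl, hk⟩
    refine ⟨_, ⟨w j, rfl⟩, _, (h' _ (hz _) _).2 ⟨rfl, ?_⟩, _, rfl, update w b (w i),
      ?_, (hb _).symm⟩
    · simp only [update_self]; rw [update_of_ne (by omega)]
    · simp only [update_self, update_idem]
      rw [← hk]
      refine (h _ (hz _) _).2 ⟨rfl, ?_⟩
      dsimp only
      rw [update_self, update_of_ne (by omega)]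

/-- Registers `b` and `b + 1` hold `k` and `h k`. Each round guesses `h (k + 1)` in `b + 2`, tests
`ψ`, shifts the guess to `b + 1` and increments `b`. The exit is nondeterministic, and the test of
`b` against register `n` makes the number of rounds exact. -/
theorem loop {b i n o : ℕ} (hi : i < b) (hn : n < b) (ho : o < b) {ψ : (ℕ → ℕ) → Prop}
    (hψ : Checkable (b + 3) ψ) :
    Checkable b (fun v => ∃ h : ℕ → ℕ, h 0 = v i ∧ h (v n) = v o ∧
      ∀ k < v n, ψ (update (update (update v b k) (b + 1) (h k)) (b + 2) (h (k + 1)))) := by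
  obtain ⟨R1, hR1, h1⟩ := eq (b := b + 2) (i := b + 1) (j := i) (by omega) (by omega)
  obtain ⟨R2, hR2, h2⟩ := eq (b := b + 2) (i := b) (j := n) (by omega) (by omega)
  obtain ⟨R3, hR3, h3⟩ := eq (b := b + 2) (i := b + 1) (j := o) (by omega) (by omega)
  obtain ⟨R, hR, hψ⟩ := hψ
  have H := (realizable_guess (b + 2)).comp (hR.comp
    ((realizable_move (i := b + 2) (j := b + 1) (by omega)).comp (realizable_instr (.inc b))))
  refine ⟨_, (realizable_guess (b + 1)).comp (hR1.comp (H.star.comp (hR2.comp (hR3.comp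
    ((realizable_clear b).comp (realizable_clear (b + 1))))))), fun v hv w => ?_⟩
  let V : ℕ → ℕ → ℕ → ℕ := fun k a => update (update v b k) (b + 1) a
  have hV : ∀ k a j, b + 2 ≤ j → V k a j = 0 := fun k a j hj => by
    have := hv j (by omega)
    simp only [V, update_apply]; grind
  have hV' : ∀ k a a' j, b + 3 ≤ j → update (V k a) (b + 2) a' j = 0 := fun k a a' j hj => by
    have := hv j (by omega)
    simp only [V, update_apply]; grind
  have hV0 : ∀ a, update v (b + 1) a = V 0 a := fun a => by
    have := hv b le_rfl
    funext m; simp only [V, update_apply]; grind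
  have hVb : ∀ k a, V k a b = k := fun k a => by simp [V]
  have hVb1 : ∀ k a, V k a (b + 1) = a := fun k a => by simp [V]
  have hVl : ∀ k a j, j < b → V k a j = v j := fun k a j hj => by
    simp only [V, update_apply]; grind
  have hVc : ∀ k a, update (update (V k a) b 0) (b + 1) 0 = v := fun k a => by
    have := hv b le_rfl
    have := hv (b + 1) (by omega)
    funext m; simp only [V, update_apply]; grind
  have hVs : ∀ k a a', update (update (update (update (V k a) (b + 2) a') (b + 1)
      (update (V k a) (b + 2) a' (b + 2))) (b + 2) 0) b
      (update (update (update (V k a) (b + 2) a') (b + 1)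
      (update (V k a) (b + 2) a' (b + 2))) (b + 2) 0 b + 1) = V (k + 1) a' := fun k a a' => by
    have := hv (b + 2) (by omega)
    funext m; simp only [V, update_apply]; grind
  constructor
  · rintro ⟨_, ⟨a, rfl⟩, u, e1, x, hx, u2, e2, u3, e3, _, rfl, rfl⟩
    rw [hV0] at e1
    obtain ⟨rfl, e1'⟩ := (h1 _ (hV _ _) u).1 e1
    have key : ∃ (k a' : ℕ) (h : ℕ → ℕ), x = V k a' ∧ h 0 = a ∧ h k = a' ∧
        ∀ l < k, ψ (update (V l (h l)) (b + 2) (h (l + 1))) := by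
      clear e2 e3
      induction hx with
      | refl => exact ⟨0, a, fun _ => a, rfl, rfl, rfl, by simp⟩
      | tail _ hs ih =>
        obtain ⟨k, a', h, rfl, hh0, hhk, hh⟩ := ih
        obtain ⟨_, ⟨a2, rfl⟩, y, hy, _, rfl, rfl⟩ := hs
        obtain ⟨rfl, hy'⟩ := (hψ _ (hV' _ _ _) y).1 hy
        -- The sequence `h` is the record of the values guessed so far.
        refine ⟨k + 1, a2, update h (k + 1) a2, hVs _ _ _, ?_, by simp, fun l hl => ?_⟩
        · rw [update_of_ne (by omega), hh0]
        · rw [update_of_ne (by omega : l ≠ k + 1)]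
          rcases eq_or_ne l k with rfl | hne
          · rw [update_self, hhk]; exact hy'
          · rw [update_of_ne (by omega)]; exact hh l (by omega)
    obtain ⟨k, a', h, rfl, hh0, hhk, hh⟩ := key
    obtain ⟨rfl, e2'⟩ := (h2 _ (hV _ _) u2).1 e2
    obtain ⟨rfl, e3'⟩ := (h3 _ (hV _ _) u3).1 e3
    dsimp only; rw [hVb, hVl _ _ _ hn] at e2'
    rw [hVb1, hVl _ _ _ ho] at e3'
    rw [hVb1, hVl _ _ _ hi] at e1'
    subst e1' e2' e3'
    exact ⟨hVc _ _, h, hh0, hhk, hh⟩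
  · rintro ⟨rfl, h, hh0, hhk, hh⟩
    have key : ∀ k ≤ w n, ReflTransGen (Comp (fun v w => ∃ k, w = update v (b + 2) k)
        (Comp R (Comp (fun v w => w = update (update v (b + 1) (v (b + 2))) (b + 2) 0)
          (Instr.inc b).Rel))) (V 0 (h 0)) (V k (h k)) := fun k hk => by
      induction k with
      | zero => exact .refl
      | succ k ih =>
        exact (ih (by omega)).tail ⟨_, ⟨h (k + 1), rfl⟩, _,
          (hψ _ (hV' _ _ _) _).2 ⟨rfl, hh k (by omega)⟩, _, rfl, (hVs _ _ _).symm⟩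
    refine ⟨_, ⟨h 0, rfl⟩, V 0 (h 0), ?_, V (w n) (h (w n)), key (w n) le_rfl, _, (h2 _ (hV _ _) _).2 ⟨rfl, ?_⟩, _,
      (h3 _ (hV _ _) _).2 ⟨rfl, ?_⟩, _, rfl, (hVc _ _).symm⟩
    · rw [hV0]
      exact (h1 _ (hV _ _) _).2 ⟨rfl, by dsimp only; rw [hVb1, hVl _ _ _ hi, hh0]⟩
    · dsimp only; rw [hVb, hVl _ _ _ hn]
    · dsimp only; rw [hVb1, hVl _ _ _ ho, hhk]

end Checkable

/-! ### Primitive recursive functions and the halting problem -/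

/-- The graph of `f` can be tested, whatever registers hold the arguments and the value. -/
def GraphCheckable {n : ℕ} (f : List.Vector ℕ n → ℕ) : Prop :=
  ∀ (b : ℕ) (ι : Fin n → ℕ) (o : ℕ), (∀ i, ι i < b) → o < b →
    Checkable b (fun v => v o = f (List.Vector.ofFn fun i => v (ι i)))

/-- The inner values are guessed in the fresh registers `b + i`, each is checked, and the outer
function is tested on them. -/
theorem graphCheckable_comp {m n : ℕ} {f : List.Vector ℕ n → ℕ} {g : Fin n → List.Vector ℕ m → ℕ}
    (hf : GraphCheckable f) (hg : ∀ i, GraphCheckable (g i)) :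
    GraphCheckable fun a => f (List.Vector.ofFn fun i => g i a) := by
  intro b ι o hι ho
  have h1 : ∀ i : Fin n, Checkable (b + n)
      (fun v => v (b + i) = g i (List.Vector.ofFn fun j => v (ι j))) := fun i =>
    hg i (b + n) ι (b + i) (fun j => by have := hι j; omega) (by omega)
  have h2 := hf (b + n) (fun i => b + i) o (fun i => by omega) (by omega)
  refine (((Checkable.forall_fin h1).and h2).exists_registers).congr fun v hv => ⟨fun h => ?_, ?_⟩
  · refine ⟨fun j => if hj : b ≤ j ∧ j < b + n then
      g ⟨j - b, by omega⟩ (List.Vector.ofFn fun j => v (ι j)) else v j, fun j hj => ?_, fun j hj => ?_,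
      fun i => ?_, ?_⟩
    · exact dif_neg (by omega)
    · exact (dif_neg (by omega)).trans (hv j (by omega))
    · have : ∀ j, ¬ (b ≤ ι j ∧ ι j < b + n) := fun j => by have := hι j; omega
      simp [this]
    · have : ¬ (b ≤ o ∧ o < b + n) := by omega
      simp [this, h]
  · rintro ⟨w, h1, -, h2, h3⟩
    have : (fun j => w (ι j)) = fun j => v (ι j) := funext fun j => h1 _ (hι j)
    rw [← h1 o ho, h3]
    simp only [h2, this]

/-- The recursion is certified by its sequence of values: the guessed register `b` holds the base
value, and the loop checks that each term follows from the preceding one. -/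
theorem graphCheckable_prec {n : ℕ} {f : List.Vector ℕ n → ℕ} {g : List.Vector ℕ (n + 2) → ℕ}
    (hf : GraphCheckable f) (hg : GraphCheckable g) :
    GraphCheckable fun v : List.Vector ℕ (n + 1) =>
      v.head.rec (f v.tail) fun y IH => g (y ::ᵥ IH ::ᵥ v.tail) := by
  intro b ι o hι ho
  have h1 := hf (b + 1) (fun i => ι i.succ) b (fun i => by have := hι i.succ; omega) (by omega)
  -- The loop starts its scratch space at `b + 1`, because `b` holds the base value: `b + 1` is the
  -- counter, `b + 2` the current value, `b + 3` the next.
  have h2 := hg (b + 1 + 3) (Fin.cons (b + 1) (Fin.cons (b + 2) (fun i => ι i.succ))) (b + 3)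
    (fun i => by
      refine Fin.cases ?_ (fun i => ?_) i
      · simp
      · refine Fin.cases ?_ (fun i => ?_) i
        · simp
        · have := hι i.succ
          simp; omega) (by omega)
  have h3 := Checkable.loop (b := b + 1) (i := b) (n := ι 0) (o := o) (by omega)
    (by have := hι 0; omega) (by omega) h2
  refine (h1.and h3).ex.congr fun v hv => ?_
  have e1 : ∀ k i, update v b k (ι i) = v (ι i) := fun k i => by
    have := hι i; rw [update_of_ne (by omega)]
  have e2 : ∀ k, update v b k o = v o := fun k => by rw [update_of_ne (by omega)]
  have e3 : ∀ u x y z i, update (update (update (update v b u) (b + 1) x) (b + 1 + 1) y) (b + 1 + 2) z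
      (ι i) = v (ι i) := fun u x y z i => by
    have := hι i; simp only [update_apply]; grind
  simp only [e1, e2, update_self, List.Vector.ofFn, Fin.cons_zero, Fin.cons_succ, e3,
    List.Vector.head_cons, List.Vector.tail_cons]
  have e4 : ∀ u x y z, update (update (update (update v b u) (b + 1) x) (b + 1 + 1) y) (b + 1 + 2) z
      (b + 1) = x := fun u x y z => by
    simp only [update_apply]; grind
  have e5 : ∀ u x y z, update (update (update (update v b u) (b + 1) x) (b + 1 + 1) y) (b + 1 + 2) z
      (b + 2) = y := fun u x y z => by
    simp only [update_apply]; grind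
  simp only [e4, e5]
  constructor
  · intro h
    exact ⟨_, rfl, fun k => Nat.rec (f (List.Vector.ofFn fun i => v (ι i.succ)))
      (fun y IH => g (y ::ᵥ IH ::ᵥ List.Vector.ofFn fun i => v (ι i.succ))) k, rfl, h.symm, fun k _ => rfl⟩
  · rintro ⟨k, hk, h, h0, hn, hs⟩
    rw [← hn]
    have : ∀ m ≤ v (ι 0), h m = Nat.rec (f (List.Vector.ofFn fun i => v (ι i.succ)))
        (fun y IH => g (y ::ᵥ IH ::ᵥ List.Vector.ofFn fun i => v (ι i.succ))) m := by
      intro m hm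
      induction m with
      | zero => exact h0.trans hk
      | succ m ih => rw [hs m (by omega), ih (by omega)]
    exact this _ le_rfl

theorem graphCheckable_of_primrec {n : ℕ} {f : List.Vector ℕ n → ℕ} (hf : Nat.Primrec' f) :
    GraphCheckable f := by
  induction hf with
  | zero => intro b ι o _ _; exact Checkable.zero b o
  | succ =>
    intro b ι o hι ho
    exact (Checkable.eq_succ ho (hι 0)).congr fun v _ => by simp
  | get i =>
    intro b ι o hι ho
    exact (Checkable.eq ho (hι i)).congr fun v _ => by simp
  | comp g _ _ hf hg => exact graphCheckable_comp hf hg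
  | prec _ _ hf hg => exact graphCheckable_prec hf hg

/-- A program that reaches its final state from the input `n` in register `0` iff the code with
number `n` halts on `0`; it can then stop with all registers cleared. -/
theorem exists_halting_machine :
    ∃ (S : Type) (_ : Fintype S) (E : List (S × Instr × S)) (s t : S), ∀ n : ℕ,
      ((∃ w, ReflTransGen (Step E) (s, update 0 0 n) (t, w)) →
        (Nat.Partrec.Code.eval (Denumerable.ofNat Nat.Partrec.Code n) 0).Dom) ∧
      ((Nat.Partrec.Code.eval (Denumerable.ofNat Nat.Partrec.Code n) 0).Dom →
        ReflTransGen (Step E) (s, update 0 0 n) (t, 0)) := by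
  let F : List.Vector ℕ 2 → ℕ := fun v =>
    Encodable.encode (Nat.Partrec.Code.evaln v.tail.head
      (Denumerable.ofNat Nat.Partrec.Code v.head) 0)
  have hF : Primrec F := by
    refine Primrec.encode.comp (Nat.Partrec.Code.primrec_evaln.comp
      ((Primrec.pair (Primrec.pair ?_ ?_) (Primrec.const 0))))
    · exact Primrec.vector_head.comp Primrec.vector_tail
    · exact (Primrec.ofNat _).comp Primrec.vector_head
  -- `none` is encoded by 0 and `some m` by a successor, so halting means that some fuel `k` makes
  -- `F` positive.
  have hdom : ∀ n, (Nat.Partrec.Code.eval (Denumerable.ofNat Nat.Partrec.Code n) 0).Dom ↔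
      ∃ k m y, y = F (n ::ᵥ k ::ᵥ List.Vector.nil) ∧ y = m + 1 := by
    intro n
    rw [Part.dom_iff_mem]
    simp only [Nat.Partrec.Code.evaln_complete, F, List.Vector.head_cons, List.Vector.tail_cons]
    constructor
    · rintro ⟨y, k, hk⟩
      rw [Option.mem_def] at hk
      exact ⟨k, y, _, rfl, by rw [hk]; simp⟩
    · rintro ⟨k, m, _, rfl, hm⟩
      cases h : Nat.Partrec.Code.evaln k (Denumerable.ofNat Nat.Partrec.Code n) 0 with
      | none => rw [h] at hm; simp at hm
      | some y => exact ⟨y, k, h⟩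
  have h1 := graphCheckable_of_primrec (Nat.Primrec'.of_prim hF) 4 (fun i => i) 3
    (fun i => by omega) (by omega)
  have h2 := Checkable.eq_succ (b := 4) (i := 3) (j := 2) (by omega) (by omega)
  obtain ⟨R, hR, hφ⟩ := ((h1.and h2).ex.ex).ex
  -- Clearing the input as well makes the final configuration unique, so that a single affine rule
  -- can recognize it later.
  obtain ⟨S, i, E, s, t, h⟩ := hR.comp (realizable_clear 0)
  have hz : ∀ n j, 1 ≤ j → update (0 : ℕ → ℕ) 0 n j = 0 := fun n j hj => by
    rw [update_of_ne (by omega)]; rfl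
  have key : ∀ n w, ReflTransGen (Step E) (s, update 0 0 n) (t, w) ↔
      w = 0 ∧ (Nat.Partrec.Code.eval (Denumerable.ofNat Nat.Partrec.Code n) 0).Dom := by
    intro n w
    rw [← h, hdom]
    have hc : update (update (0 : ℕ → ℕ) 0 n) 0 0 = 0 := by
      rw [update_idem]; exact update_eq_self 0 (0 : ℕ → ℕ)
    have hiff := fun u => hφ _ (hz n) u
    have hv : ∀ k m y : ℕ, (List.Vector.ofFn fun i : Fin 2 =>
        update (update (update (update (0 : ℕ → ℕ) 0 n) 1 k) (1 + 1) m) (1 + 1 + 1) y i) =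
        n ::ᵥ k ::ᵥ List.Vector.nil := fun k m y => by
      simp [List.Vector.ofFn]
    have hy : ∀ k m y : ℕ,
        update (update (update (update (0 : ℕ → ℕ) 0 n) 1 k) (1 + 1) m) (1 + 1 + 1) y 3 = y :=
      fun k m y => update_self ..
    have hm : ∀ k m y : ℕ,
        update (update (update (update (0 : ℕ → ℕ) 0 n) 1 k) (1 + 1) m) (1 + 1 + 1) y 2 = m :=
      fun k m y => by simp
    simp only [hv, hy, hm] at hiff
    constructor
    · rintro ⟨u, hu, rfl⟩
      obtain ⟨rfl, hd⟩ := (hiff u).1 hu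
      exact ⟨hc, hd⟩
    · rintro ⟨rfl, hd⟩
      exact ⟨_, (hiff _).2 ⟨rfl, hd⟩, hc.symm⟩
  exact ⟨S, i, E, s, t, fun n => ⟨fun ⟨w, hw⟩ => ((key n w).1 hw).2, fun hd => (key n 0).2 ⟨rfl, hd⟩⟩⟩

end CounterMachine

/-! ### Affine rules simulating counter machines -/

/-- The rule `m y + r ↦ a y + b` (`y : ℕ`) on natural numbers. -/
structure AffineRule where
  (m r a b : ℕ)

namespace AffineRule

open Relation Function CounterMachine

/-- `x'` is obtained from `x` by the rule. -/
def Rel (ρ : AffineRule) (x x' : ℕ) : Prop := ∃ y, x = ρ.m * y + ρ.r ∧ x' = ρ.a * y + ρ.b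

/-- `x'` is obtained from `x` by one of the rules of the list. -/
def Step (L : List AffineRule) (x x' : ℕ) : Prop := ∃ ρ ∈ L, ρ.Rel x x'

/-- The rule that acts like `ρ` on quotients modulo `M` and changes the remainder `q` to `q'`. -/
def lift (M q q' : ℕ) (ρ : AffineRule) : AffineRule :=
  ⟨M * ρ.m, M * ρ.r + q, M * ρ.a, M * ρ.b + q'⟩

theorem lift_rel {M q q' : ℕ} {ρ : AffineRule} {p z x' : ℕ} (hp : p < M) (hq : q < M) :
    (lift M q q' ρ).Rel (M * z + p) x' ↔ p = q ∧ ∃ z', ρ.Rel z z' ∧ x' = M * z' + q' := by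
  simp only [Rel, lift]
  constructor
  · rintro ⟨y, h, rfl⟩
    have h' : M * z + p = M * (ρ.m * y + ρ.r) + q := by rw [h]; ring
    have hpq : p = q := by
      have := congrArg (· % M) h'
      simpa [Nat.mul_add_mod, Nat.mod_eq_of_lt, hp, hq] using this
    subst hpq
    refine ⟨rfl, ρ.a * y + ρ.b, ⟨y, ?_, rfl⟩, by ring⟩
    exact Nat.eq_of_mul_eq_mul_left (by omega) (Nat.add_right_cancel h')
  · rintro ⟨rfl, z', ⟨y, rfl, rfl⟩, rfl⟩
    exact ⟨y, by ring, by ring⟩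

/-- Register contents as exponents in a prime factorization. -/
noncomputable def enc (B : ℕ) (v : ℕ → ℕ) : ℕ :=
  ∏ i ∈ Finset.range B, Nat.nth Nat.Prime i ^ v i

theorem enc_update_add {B i : ℕ} (hi : i < B) (v : ℕ → ℕ) (k : ℕ) :
    enc B (update v i (v i + k)) = Nat.nth Nat.Prime i ^ k * enc B v := by
  have hi' : i ∈ Finset.range B := Finset.mem_range.2 hi
  simp only [enc]
  rw [← Finset.mul_prod_erase _ _ hi', ← Finset.mul_prod_erase _ (fun j => _ ^ v j) hi', update_self,
    pow_add, mul_comm (_ ^ v i), mul_assoc]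
  congr 2
  exact Finset.prod_congr rfl fun j hj => by rw [update_of_ne (Finset.ne_of_mem_erase hj)]

theorem dvd_enc_iff {B i : ℕ} (hi : i < B) (v : ℕ → ℕ) :
    Nat.nth Nat.Prime i ∣ enc B v ↔ v i ≠ 0 := by
  have hp := Nat.prime_nth_prime
  constructor
  · intro h h0
    obtain ⟨j, hj, h⟩ := (hp i).prime.exists_mem_finset_dvd h
    have h := (Nat.prime_dvd_prime_iff_eq (hp i) (hp j)).1 ((hp i).dvd_of_dvd_pow h)
    have : i = j := Nat.nth_injective Nat.infinite_setOfPred_prime h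
    subst this
    rw [h0, pow_zero] at *
    have h1 := (hp i).one_lt
    have := Nat.le_of_dvd one_pos ‹_ ∣ 1›
    omega
  · intro h
    exact (dvd_pow_self _ h).trans (Finset.dvd_prod_of_mem _ (Finset.mem_range.2 hi))

/-- The register that an instruction uses (`0` if there is none). -/
def register : Instr → ℕ
  | .skip => 0
  | .inc i => i
  | .dec i => i
  | .zero i => i

/-- The rules that carry out an instruction on encoded registers. -/
noncomputable def ofInstr : Instr → List AffineRule
  | .skip => [⟨1, 0, 1, 0⟩]
  | .inc i => [⟨1, 0, Nat.nth Nat.Prime i, 0⟩]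
  | .dec i => [⟨Nat.nth Nat.Prime i, 0, 1, 0⟩]
  | .zero i => ((List.range (Nat.nth Nat.Prime i)).filter (· ≠ 0)).map fun r =>
      ⟨Nat.nth Nat.Prime i, r, Nat.nth Nat.Prime i, r⟩

/-- Increment multiplies by the prime of the register and decrement divides by it, which is possible
only if the register is nonzero. The zero test is the identity on each nonzero residue class modulo
that prime. -/
theorem step_ofInstr {B : ℕ} {I : Instr} (hI : register I < B) (v : ℕ → ℕ) (z : ℕ) :
    Step (ofInstr I) (enc B v) z ↔ ∃ w, I.Rel v w ∧ z = enc B w := by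
  cases I with
  | skip => simp [Step, ofInstr, Instr.Rel, Rel]
  | inc i =>
    have := enc_update_add hI v 1
    simp only [register] at this
    simp [Step, ofInstr, Instr.Rel, Rel, this]
  | dec i =>
    simp only [Step, ofInstr, Instr.Rel, Rel, List.mem_singleton, exists_eq_left, add_zero, one_mul]
    constructor
    · rintro ⟨y, hy, rfl⟩
      have h0 : v i ≠ 0 := (dvd_enc_iff hI v).1 ⟨_, hy⟩
      refine ⟨_, ⟨h0, rfl⟩, ?_⟩
      have := enc_update_add hI (update v i (v i - 1)) 1
      simp only [register, update_self, update_idem, Nat.sub_add_cancel (Nat.pos_of_ne_zero h0),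
        update_eq_self, pow_one] at this
      exact Nat.eq_of_mul_eq_mul_left (Nat.prime_nth_prime i).pos (hy.symm.trans this)
    · rintro ⟨w, ⟨h0, rfl⟩, rfl⟩
      refine ⟨_, ?_, rfl⟩
      have := enc_update_add hI (update v i (v i - 1)) 1
      simpa only [register, update_self, update_idem, Nat.sub_add_cancel (Nat.pos_of_ne_zero h0),
        update_eq_self, pow_one] using this
  | zero i =>
    have hd := dvd_enc_iff hI v
    simp only [register] at hd
    simp only [Step, ofInstr, Instr.Rel, Rel, List.mem_map, List.mem_filter, List.mem_range,
      decide_eq_true_eq]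
    constructor
    · rintro ⟨_, ⟨r, ⟨hr, h0⟩, rfl⟩, y, hy, rfl⟩
      refine ⟨v, ⟨by_contra fun hv => ?_, rfl⟩, hy.symm⟩
      rw [← ne_eq, ← hd, hy, Nat.dvd_add_right (dvd_mul_right _ _)] at hv
      exact absurd (Nat.le_of_dvd (Nat.pos_of_ne_zero h0) hv) (by omega)
    · rintro ⟨w, ⟨h0, rfl⟩, rfl⟩
      have h1 := Nat.div_add_mod (enc B w) (Nat.nth Nat.Prime i)
      refine ⟨_, ⟨enc B w % Nat.nth Nat.Prime i, ⟨Nat.mod_lt _ (Nat.prime_nth_prime i).pos, ?_⟩, rfl⟩,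
        enc B w / Nat.nth Nat.Prime i, h1.symm, h1.symm⟩
      intro h
      exact (not_iff_not.2 hd).2 (by simpa using h0) (Nat.dvd_of_mod_eq_zero h)

/-- The halting problem is a reachability problem for a fixed finite list of affine rules. -/
theorem exists_halting_rules :
    ∃ (L : List AffineRule) (x₀ : ℕ → ℕ), Primrec x₀ ∧ ∀ n : ℕ,
      (Nat.Partrec.Code.eval (Denumerable.ofNat Nat.Partrec.Code n) 0).Dom ↔
        ReflTransGen (Step L) (x₀ n) 0 := by
  obtain ⟨S, _, E, s, t, hE⟩ := exists_halting_machine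
  obtain ⟨B, hB⟩ : ∃ B, ∀ e ∈ E, register e.2.1 < B := by
    refine ⟨(E.map fun e => register e.2.1).sum + 1, fun e he => Nat.lt_succ_of_le ?_⟩
    exact List.le_sum_of_mem (List.mem_map.2 ⟨e, he, rfl⟩)
  let M := Fintype.card S + 1
  -- The shift by 1 keeps all codes nonzero, so 0 is free to signal halting.
  let st : S → ℕ := fun q => (Fintype.equivFin S q : ℕ) + 1
  have hst : ∀ q, st q < M := fun q => by simp [st, M]
  have hst0 : ∀ q, st q ≠ 0 := fun q => by simp [st]
  have hinj : ∀ p q, st p = st q → p = q := fun p q h => by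
    simpa [st, Fin.val_inj] using h
  -- With `B + 1` registers the input register 0 is encoded even when `B = 0`.
  let code : S × (ℕ → ℕ) → ℕ := fun c => M * enc (B + 1) c.2 + st c.1
  -- The extra rule has `m = 0`, so it applies to the number `code (t, 0)` alone.
  let L : List AffineRule := ⟨0, code (t, 0), 0, 0⟩ ::
    E.flatMap fun e => (ofInstr e.2.1).map (lift M (st e.1) (st e.2.2))
  have hstep : ∀ c x', Step L (code c) x' ↔
      (x' = 0 ∧ code c = code (t, 0)) ∨ ∃ d, CounterMachine.Step E c d ∧ x' = code d := by
    intro c x'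
    constructor
    · rintro ⟨ρ, hρ, hr⟩
      simp only [L, List.mem_cons, List.mem_flatMap, List.mem_map] at hρ
      rcases hρ with rfl | ⟨⟨p, I, q⟩, he, ρ, hρ, rfl⟩
      · obtain ⟨y, h1, h2⟩ := hr
        exact .inl ⟨by simpa using h2, by simpa using h1⟩
      · obtain ⟨hp, z', hz, rfl⟩ := (lift_rel (hst _) (hst _)).1 hr
        obtain ⟨w, hw, rfl⟩ :=
          (step_ofInstr (B := B + 1) ((hB _ he).trans B.lt_succ_self) c.2 z').1 ⟨ρ, hρ, hz⟩
        have := hinj _ _ hp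
        dsimp only at this
        subst this
        exact .inr ⟨(q, w), ⟨I, he, hw⟩, rfl⟩
    · rintro (⟨rfl, h⟩ | ⟨d, ⟨I, he, hI⟩, rfl⟩)
      · exact ⟨_, List.mem_cons_self, 0, by simpa using h, by simp⟩
      · obtain ⟨ρ, hρ, hr⟩ :=
          (step_ofInstr (B := B + 1) ((hB _ he).trans B.lt_succ_self) c.2 _).2 ⟨_, hI, rfl⟩
        refine ⟨lift M (st c.1) (st d.1) ρ, ?_, (lift_rel (hst _) (hst _)).2 ⟨rfl, _, hr, rfl⟩⟩
        simp only [L, List.mem_cons, List.mem_flatMap, List.mem_map]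
        exact .inr ⟨_, he, ρ, hρ, rfl⟩
  have hcode0 : ∀ c, code c ≠ 0 := fun c => by
    have := hst0 c.1
    simp only [code]; omega
  have hstep0 : ∀ x', ¬ Step L 0 x' := by
    rintro x' ⟨ρ, hρ, y, h1, -⟩
    simp only [L, List.mem_cons, List.mem_flatMap, List.mem_map] at hρ
    rcases hρ with rfl | ⟨⟨p, I, q⟩, he, ρ, hρ, rfl⟩
    · have := hcode0 (t, 0)
      dsimp only at h1; omega
    · have := hst0 p
      simp only [lift] at h1; omega
  have hreach : ∀ c x, ReflTransGen (Step L) (code c) x →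
      (∃ d, ReflTransGen (CounterMachine.Step E) c d ∧ x = code d) ∨
      (x = 0 ∧ ∃ w, ReflTransGen (CounterMachine.Step E) c (t, w)) := by
    intro c x h
    induction h with
    | refl => exact .inl ⟨c, .refl, rfl⟩
    | tail _ hs ih =>
      rcases ih with ⟨d, hd, rfl⟩ | ⟨rfl, -⟩
      · rcases (hstep _ _).1 hs with ⟨rfl, h⟩ | ⟨d', hd', rfl⟩
        · refine .inr ⟨rfl, d.2, ?_⟩
          -- Only the state is recovered from the code; that suffices, since reaching `t` with any
          -- register contents implies halting.
          have : st d.1 = st t := by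
            have := congrArg (· % M) h
            simpa [code, Nat.mul_add_mod, Nat.mod_eq_of_lt, hst] using this
          rwa [← hinj _ _ this]
        · exact .inl ⟨d', hd.tail hd', rfl⟩
      · exact absurd hs (hstep0 _)
  have hreach' : ∀ c d, ReflTransGen (CounterMachine.Step E) c d →
      ReflTransGen (Step L) (code c) (code d) := fun c d h =>
    ReflTransGen.lift (p := Step L) code (fun c d h => (hstep _ _).2 (.inr ⟨d, h, rfl⟩)) _ _ h
  refine ⟨L, fun n => code (s, update 0 0 n), ?_, fun n => ⟨fun h => ?_, fun h => ?_⟩⟩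
  · have h1 : ∀ n, code (s, update 0 0 n) = M * Nat.nth Nat.Prime 0 ^ n + st s := fun n => by
      have := enc_update_add (B := B + 1) (Nat.succ_pos B) 0 n
      simp only [Pi.zero_apply, zero_add] at this
      have h0 : enc (B + 1) 0 = 1 := by simp [enc]
      simp only [code, this, h0, mul_one]
    have h2 : Primrec fun n : ℕ => Nat.nth Nat.Prime 0 ^ n := by
      refine (Primrec.nat_iff.2 Nat.Primrec.pow).comp
        (Primrec₂.natPair.comp (Primrec.const (Nat.nth Nat.Prime 0)) Primrec.id) |>.of_eq fun n => ?_
      simp [Nat.unpaired]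
    exact (Primrec.nat_add.comp (Primrec.nat_mul.comp (Primrec.const M) h2)
      (Primrec.const (st s))).of_eq fun n => (h1 n).symm
  · exact (hreach' _ _ ((hE n).2 h)).tail ((hstep _ _).2 (.inl ⟨rfl, rfl⟩))
  · rcases hreach _ _ h with ⟨d, -, hd⟩ | ⟨-, hw⟩
    · exact absurd hd.symm (hcode0 d)
    · exact (hE n).1 hw

end AffineRule

/-! ### Derivations checked by a linear action on monomials -/

namespace PFA

open Relation

/-- Reading a letter: `none` increments the second coordinate; a rule replaces the first coordinate,
using the second one as the parameter, and adds the squared mismatch to the third coordinate. -/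
def act (c : ℕ × ℕ × ℤ) : Option AffineRule → ℕ × ℕ × ℤ
  | none => (c.1, c.2.1 + 1, c.2.2)
  | some ρ => (ρ.a * c.2.1 + ρ.b, 0, c.2.2 + ((c.1 : ℤ) - ρ.m * c.2.1 - ρ.r) ^ 2)

/-- The monomials that determine the behaviour of a configuration under `act`. -/
def monomials (c : ℕ × ℕ × ℤ) : Fin 7 → ℚ :=
  ![1, -c.2.2, -c.1 ^ 2, c.1, c.2.1, c.1 * c.2.1, c.2.1 ^ 2]

/-- The action of a letter on the monomials. -/
def actMatrix : Option AffineRule → Matrix (Fin 7) (Fin 7) ℚ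
  | none =>
    !![1, 0, 0, 0, 1, 0, 1;
       0, 1, 0, 0, 0, 0, 0;
       0, 0, 1, 0, 0, 0, 0;
       0, 0, 0, 1, 0, 1, 0;
       0, 0, 0, 0, 1, 0, 2;
       0, 0, 0, 0, 0, 1, 0;
       0, 0, 0, 0, 0, 0, 1]
  | some ρ =>
    !![1, -ρ.r ^ 2, -ρ.b ^ 2, ρ.b, 0, 0, 0;
       0, 1, 0, 0, 0, 0, 0;
       0, 1, 0, 0, 0, 0, 0;
       0, 2 * ρ.r, 0, 0, 0, 0, 0;
       0, -2 * ρ.m * ρ.r, -2 * ρ.a * ρ.b, ρ.a, 0, 0, 0;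
       0, 2 * ρ.m, 0, 0, 0, 0, 0;
       0, -ρ.m ^ 2, -ρ.a ^ 2, 0, 0, 0, 0]

/-- The span of these monomials is closed under both kinds of letters. A rule makes the new x a
function of y alone and resets y to 0, so no degree above two arises; the mismatch squared uses x²,
xy, y² and lower terms. -/
theorem monomials_vecMul (c : ℕ × ℕ × ℤ) (l : Option AffineRule) :
    monomials c ᵥ* actMatrix l = monomials (act c l) := by
  cases l with
  | none =>
    ext i
    fin_cases i <;> simp [monomials, actMatrix, act, vecMul, dotProduct, Fin.sum_univ_succ] <;> ring
  | some ρ =>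
    ext i
    fin_cases i <;> simp [monomials, actMatrix, act, vecMul, dotProduct, Fin.sum_univ_succ] <;> ring

/-! ### From linear maps to stochastic matrices -/

/-- An embedding of row vectors of length 7 into those of length 12 with sum zero. -/
def embed : Matrix (Fin 7) (Fin 12) ℚ :=
  of fun i j => if j.val = i.val then 1 else if j.val = 7 then -1 else 0

/-- A left inverse of `embed` that vanishes on the constant vectors. -/
def retract : Matrix (Fin 12) (Fin 7) ℚ :=
  of fun i j => if i.val = j.val then 1 else if i.val = 8 then -1 else 0

/-- The balancing entries -1 sit in column 7 of `embed` and in row 8 of `retract`, so they never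
meet in the product. -/
theorem embed_mul_retract : embed * retract = 1 := by
  ext i j
  fin_cases i <;> fin_cases j <;> simp [embed, retract, Matrix.mul_apply, Fin.sum_univ_succ]

theorem sum_retract (j : Fin 7) : ∑ i, retract i j = 0 := by
  fin_cases j <;> simp [retract, Fin.sum_univ_succ]

theorem sum_embed (i : Fin 7) : ∑ j, embed i j = 0 := by
  fin_cases i <;> simp [embed, Fin.sum_univ_succ]

/-- The action of a letter on row vectors of length 12; rows and columns have sum zero. -/
def zeroSumMatrix (l : Option AffineRule) : Matrix (Fin 12) (Fin 12) ℚ :=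
  retract * actMatrix l * embed

theorem sum_zeroSumMatrix_row (l : Option AffineRule) (i : Fin 12) :
    ∑ j, zeroSumMatrix l i j = 0 := by
  simp only [zeroSumMatrix, Matrix.mul_apply (N := embed)]
  rw [Finset.sum_comm]
  simp [← Finset.mul_sum, sum_embed]

theorem sum_zeroSumMatrix_col (l : Option AffineRule) (j : Fin 12) :
    ∑ i, zeroSumMatrix l i j = 0 := by
  simp only [zeroSumMatrix, Matrix.mul_assoc, Matrix.mul_apply (M := retract)]
  rw [Finset.sum_comm]
  simp [← Finset.sum_mul, sum_retract]

theorem embed_vecMul_zeroSumMatrix (c : ℕ × ℕ × ℤ) (l : Option AffineRule) :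
    (monomials c ᵥ* embed) ᵥ* zeroSumMatrix l = monomials (act c l) ᵥ* embed := by
  rw [zeroSumMatrix, vecMul_vecMul, Matrix.mul_assoc, ← Matrix.mul_assoc, embed_mul_retract,
    Matrix.one_mul, ← vecMul_vecMul, monomials_vecMul]

theorem sum_vecMul_embed (s : Fin 7 → ℚ) : ∑ j, (s ᵥ* embed) j = 0 := by
  simp only [vecMul, dotProduct]
  rw [Finset.sum_comm]
  simp [← Finset.mul_sum, sum_embed]

/-- A bound for the entries of `zeroSumMatrix`. -/
def scale (l : Option AffineRule) : ℚ := 1 + ∑ i, ∑ j, |zeroSumMatrix l i j|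

theorem scale_pos (l : Option AffineRule) : 0 < scale l := by
  unfold scale; positivity

theorem abs_zeroSumMatrix_le (l : Option AffineRule) (i j : Fin 12) :
    |zeroSumMatrix l i j| ≤ scale l := by
  have h1 := Finset.single_le_sum (f := fun j => |zeroSumMatrix l i j|)
    (fun _ _ => abs_nonneg _) (Finset.mem_univ j)
  have h2 := Finset.single_le_sum (f := fun i => ∑ j, |zeroSumMatrix l i j|)
    (fun _ _ => Finset.sum_nonneg fun _ _ => abs_nonneg _) (Finset.mem_univ i)
  beta_reduce at h1 h2
  unfold scale
  linarith

/-- The transition matrix of a letter, a perturbation of the uniform one. -/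
def transMatrix (l : Option AffineRule) : Matrix (Fin 12) (Fin 12) ℚ :=
  of fun i j => 1 / 12 * (1 + zeroSumMatrix l i j / scale l)

theorem transMatrix_mem (l : Option AffineRule) :
    transMatrix l ∈ Matrix.rowStochastic ℚ (Fin 12) := by
  rw [mem_rowStochastic_iff_sum]
  refine ⟨fun i j => ?_, fun i => ?_⟩
  · have h := (abs_le.1 (abs_zeroSumMatrix_le l i j)).1
    have : -1 ≤ zeroSumMatrix l i j / scale l := by
      rw [le_div_iff₀ (scale_pos l)]; linarith
    simp only [transMatrix, of_apply]
    linarith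
  · simp [transMatrix, ← Finset.mul_sum, Finset.sum_add_distrib, ← Finset.sum_div,
      sum_zeroSumMatrix_row]

/-- The distribution on states that represents a configuration, with deviation `δ` from the uniform
distribution. -/
def distribution (δ : ℚ) (c : ℕ × ℕ × ℤ) : Fin 12 → ℚ :=
  fun j => 1 / 12 * (1 + δ * (monomials c ᵥ* embed) j)

/-- The cross terms between uniform parts and deviations vanish because the deviation vector and the
columns of `zeroSumMatrix` sum to zero. -/
theorem distribution_vecMul (δ : ℚ) (c : ℕ × ℕ × ℤ) (l : Option AffineRule) :
    distribution δ c ᵥ* transMatrix l = distribution (δ / (12 * scale l)) (act c l) := by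
  ext j
  have h := congrFun (embed_vecMul_zeroSumMatrix c l) j
  have hs := (scale_pos l).ne'
  simp only [distribution]
  rw [← h]
  generalize hd : monomials c ᵥ* embed = d
  have hd0 : ∑ i, d i = 0 := hd ▸ sum_vecMul_embed _
  simp only [vecMul, dotProduct, transMatrix, of_apply]
  have : ∀ i, 1 / 12 * (1 + δ * d i) * (1 / 12 * (1 + zeroSumMatrix l i j / scale l)) =
      1 / 144 + δ / 144 * d i + 1 / (144 * scale l) * zeroSumMatrix l i j +
        δ / (144 * scale l) * (d i * zeroSumMatrix l i j) := fun i => by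
    field_simp; ring
  have e : ∀ i, distribution δ c i = 1 / 12 * (1 + δ * d i) := fun i => by rw [← hd]; rfl
  simp only [e]
  refine (Finset.sum_congr rfl fun i _ => this i).trans ?_
  simp only [Finset.sum_add_distrib, ← Finset.mul_sum, hd0, sum_zeroSumMatrix_col]
  simp only [Finset.sum_const, Finset.card_univ, Fintype.card_fin, nsmul_eq_mul]
  field_simp
  norm_num
  ring

/-- The deviation is rescaled by a positive factor at each letter; only its sign matters for the
cutpoint, so the size of `δ'` is left open. -/
theorem distribution_vecMul_prod (w : List (Option AffineRule)) {δ : ℚ} (hδ : 0 < δ)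
    (c : ℕ × ℕ × ℤ) : ∃ δ', 0 < δ' ∧
      distribution δ c ᵥ* (w.map transMatrix).prod = distribution δ' (w.foldl act c) := by
  induction w generalizing δ c with
  | nil => exact ⟨δ, hδ, by simp⟩
  | cons l w ih =>
    have := scale_pos l
    obtain ⟨δ', h0, h⟩ := ih (δ := δ / (12 * scale l)) (by positivity) (act c l)
    exact ⟨δ', h0, by rw [List.map_cons, List.prod_cons, ← vecMul_vecMul, distribution_vecMul, h,
      List.foldl_cons]⟩

/-- Numerators of the starting distribution. -/
def startNum (x : ℕ) : Fin 12 → ℕ :=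
  ![x ^ 2 + x + 2, x ^ 2 + x + 1, x + 1, x ^ 2 + 2 * x + 1, x ^ 2 + x + 1, x ^ 2 + x + 1,
    x ^ 2 + x + 1, 2 * x ^ 2, x ^ 2 + x + 1, x ^ 2 + x + 1, x ^ 2 + x + 1, x ^ 2 + x + 1]

/-- The common denominator of the starting distribution. -/
def startDen (x : ℕ) : ℕ := 12 * (x ^ 2 + x + 1)

theorem distribution_start (x : ℕ) (j : Fin 12) :
    distribution (1 / (x ^ 2 + x + 1)) (x, 0, 0) j = (startNum x j : ℚ) / (startDen x : ℚ) := by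
  have : (x : ℚ) ^ 2 + x + 1 ≠ 0 := by positivity
  fin_cases j <;>
  simp [distribution, monomials, embed, vecMul, dotProduct, Fin.sum_univ_succ, startNum, startDen] <;>
  field_simp <;> ring

/-- No entry of the embedded starting vector is below -(x² + x + 1), which dictates the initial
deviation. -/
theorem distribution_start_mem (x : ℕ) :
    distribution (1 / (x ^ 2 + x + 1)) (x, 0, 0) ∈ stdSimplex ℚ (Fin 12) := by
  refine ⟨fun j => ?_, ?_⟩
  · rw [distribution_start]; positivity
  · simp [distribution, ← Finset.mul_sum, Finset.sum_add_distrib, sum_vecMul_embed]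

/-! ### The automaton and its language -/

/-- The automaton for the rules `L` and the starting number `x`. -/
def ofRules (L : List AffineRule) (x : ℕ) :
    PFA (Fin 12) (Fin (none :: L.map some : List (Option AffineRule)).length) where
  start := distribution (1 / (x ^ 2 + x + 1)) (x, 0, 0)
  trans a := transMatrix ((none :: L.map some).get a)
  accept q := decide (q.val < 3)
  start_mem := distribution_start_mem x
  trans_mem _ := transMatrix_mem _

/-- The accepting states 0, 1, 2 carry the monomials 1, -e, -x². Their uniform share is 3/12, which
is the cutpoint; the padding to 12 states serves this purpose. -/
theorem mem_language_ofRules (L : List AffineRule) (x : ℕ)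
    (w : List (Fin (none :: L.map some : List (Option AffineRule)).length)) :
    w ∈ (ofRules L x).language (1 / 4) ↔
      ((w.map (none :: L.map some).get).foldl act (x, 0, 0)).2.2 +
        (((w.map (none :: L.map some).get).foldl act (x, 0, 0)).1 : ℤ) ^ 2 < 1 := by
  obtain ⟨δ, hδ, h⟩ := distribution_vecMul_prod (w.map (none :: L.map some).get)
    (δ := 1 / (x ^ 2 + x + 1)) (by positivity) (x, 0, 0)
  have : (ofRules L x).acceptProb w = 1 / 4 + δ / 12 *
      (1 - ((w.map (none :: L.map some).get).foldl act (x, 0, 0)).2.2 -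
        (((w.map (none :: L.map some).get).foldl act (x, 0, 0)).1 : ℚ) ^ 2) := by
    rw [acceptProb, dotProduct_mulVec]
    have h' : (ofRules L x).start ᵥ* (w.map (ofRules L x).trans).prod =
        distribution δ ((w.map (none :: L.map some).get).foldl act (x, 0, 0)) := by
      rw [← h, List.map_map]; rfl
    rw [h']
    simp [distribution, monomials, embed, vecMul, dotProduct, Fin.sum_univ_succ, acceptVec, ofRules]
    ring
  change 1 / 4 < (ofRules L x).acceptProb w ↔ _
  rw [this]
  generalize (w.map (none :: L.map some).get).foldl act (x, 0, 0) = c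
  rw [lt_add_iff_pos_right, mul_pos_iff_of_pos_left (by positivity), sub_sub, sub_pos]
  exact_mod_cast Iff.rfl

/-- The error is a sum of integer squares, so a single misapplied rule makes it at least 1 forever,
and acceptance forces both error and final number to vanish. Conversely, a derivation is spelled out
with each parameter written in unary. -/
theorem exists_mem_language_ofRules (L : List AffineRule) (x : ℕ) :
    (∃ w, w ∈ (ofRules L x).language (1 / 4)) ↔ ReflTransGen (AffineRule.Step L) x 0 := by
  simp only [mem_language_ofRules]
  constructor
  · rintro ⟨w, hw⟩
    have key : ∀ w : List (Option AffineRule), (∀ l ∈ w, l ∈ none :: L.map some) →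
        ∀ c : ℕ × ℕ × ℤ, (0 ≤ c.2.2 ∧ (c.2.2 = 0 → ReflTransGen (AffineRule.Step L) x c.1)) →
        0 ≤ (w.foldl act c).2.2 ∧
          ((w.foldl act c).2.2 = 0 → ReflTransGen (AffineRule.Step L) x (w.foldl act c).1) := by
      intro w
      induction w with
      | nil => intro _ c hc; exact hc
      | cons l w ih =>
        intro hl c hc
        refine ih (fun l' hl' => hl l' (List.mem_cons_of_mem _ hl')) _ ?_
        have hl := hl l List.mem_cons_self
        rcases l with _ | ρ
        · exact hc
        · have hρ : ρ ∈ L := by simpa using hl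
          refine ⟨add_nonneg hc.1 (sq_nonneg _), fun h0 => ?_⟩
          simp only [act] at h0 ⊢
          have hsq := sq_nonneg ((c.1 : ℤ) - ρ.m * c.2.1 - ρ.r)
          have h1 : c.2.2 = 0 := by linarith [hc.1]
          have h2 : (c.1 : ℤ) - ρ.m * c.2.1 - ρ.r = 0 := by
            rw [h1, zero_add] at h0
            exact pow_eq_zero_iff (two_ne_zero) |>.1 h0
          refine (hc.2 h1).tail ⟨ρ, hρ, c.2.1, ?_, rfl⟩
          have : (c.1 : ℤ) = ρ.m * c.2.1 + ρ.r := by linarith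
          exact_mod_cast this
    obtain ⟨h1, h2⟩ := key (w.map (none :: L.map some).get)
      (fun l hl => by
        obtain ⟨a, _, rfl⟩ := List.mem_map.1 hl
        exact List.get_mem _ a) (x, 0, 0) ⟨le_rfl, fun _ => .refl⟩
    generalize (w.map (none :: L.map some).get).foldl act (x, 0, 0) = c at hw h1 h2
    have hsq := sq_nonneg (c.1 : ℤ)
    have h3 : (c.1 : ℤ) ^ 2 = 0 := by omega
    have h4 : c.1 = 0 := by exact_mod_cast pow_eq_zero_iff (two_ne_zero) |>.1 h3
    have := h2 (by omega)
    rwa [h4] at this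
  · intro h
    have key : ∀ z, ReflTransGen (AffineRule.Step L) x z →
        ∃ w : List (Fin (none :: L.map some : List (Option AffineRule)).length),
          (w.map (none :: L.map some).get).foldl act (x, 0, 0) = (z, 0, 0) := by
      intro z hz
      induction hz with
      | refl => exact ⟨[], rfl⟩
      | tail _ hs ih =>
        obtain ⟨w, hw⟩ := ih
        obtain ⟨ρ, hρ, y, rfl, rfl⟩ := hs
        obtain ⟨a, ha⟩ := List.mem_iff_get.1
          (List.mem_cons_of_mem (none : Option AffineRule) (List.mem_map_of_mem (f := some) hρ))
        -- Letter 0 is `none`; it raises the parameter from 0 to the required `y`.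
        have hy : ∀ y z : ℕ, ((List.replicate y (0 : Fin (L.map some).length.succ)).map
            (none :: L.map some).get).foldl act (z, 0, 0) = (z, y, 0) := by
          intro y z
          induction y with
          | zero => rfl
          | succ y ih =>
            rw [List.replicate_succ', List.map_append, List.foldl_append, ih]
            rfl
        refine ⟨w ++ (List.replicate y 0 ++ [a]), ?_⟩
        rw [List.map_append, List.foldl_append, hw, List.map_append, List.foldl_append]
        erw [hy]
        rw [List.map_singleton, ha]
        simp [act]
    obtain ⟨w, hw⟩ := key 0 h
    exact ⟨w, by rw [hw]; simp⟩

/-! ### Computability of the reduction -/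

/-- A nonnegative rational number as a fraction of natural numbers. -/
def fraction (q : ℚ) : ℕ × ℕ := (q.num.toNat, q.den)

theorem isFraction_fraction {q : ℚ} (hq : 0 ≤ q) : IsFraction (fraction q) q := by
  refine ⟨q.den_ne_zero, ?_⟩
  have : (q.num.toNat : ℚ) = (q.num : ℚ) :=
    congrArg (Int.cast : ℤ → ℚ) (Int.toNat_of_nonneg (Rat.num_nonneg.2 hq))
  simp only [fraction, this]
  exact Rat.num_div_den q

/-- A presentation of `ofRules L x`. -/
def codeOfRules (L : List AffineRule) (x : ℕ) : Code 12 :=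
  (fun q => (startNum x q, startDen x),
    (none :: L.map some).map fun l i j => fraction (transMatrix l i j),
    fun q => decide (q.val < 3))

theorem represents_codeOfRules (L : List AffineRule) (x : ℕ) :
    Represents (codeOfRules L x) (ofRules L x) where
  start q := ⟨by simp [codeOfRules, startDen], (distribution_start x q).symm⟩
  length := by simp [codeOfRules]
  trans a p q := by
    have h : ∀ l, IsFraction (fraction (transMatrix l p q)) (transMatrix l p q) := fun l =>
      isFraction_fraction (nonneg_of_mem_rowStochastic (transMatrix_mem l))
    have e : (codeOfRules L x).2.1[(a : ℕ)]'(by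
        have := a.isLt
        simp only [codeOfRules, List.length_cons, List.length_map] at this ⊢
        exact this) =
        fun i j => fraction (transMatrix ((none :: L.map some).get a) i j) := List.getElem_map ..
    rw [e]
    exact h _
  accept := rfl

theorem primrec_startNum : Primrec startNum := by
  rw [Primrec.fin_curry]
  refine (Primrec.fin_curry₁.2 ?_ : Primrec₂ fun (i : Fin 12) x => startNum x i).swap
  have hx : Primrec fun x : ℕ => x := Primrec.id
  have h2 : Primrec fun x : ℕ => x ^ 2 :=
    (Primrec.nat_mul.comp hx hx).of_eq fun x => (sq x).symm
  have hT : Primrec fun x : ℕ => x ^ 2 + x := Primrec.nat_add.comp h2 hx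
  have c : ∀ {f : ℕ → ℕ} (k : ℕ), Primrec f → Primrec fun x => f x + k := fun k hf =>
    Primrec.nat_add.comp hf (Primrec.const k)
  intro i
  fin_cases i
  · exact c 2 hT
  · exact c 1 hT
  · exact c 1 hx
  · exact c 1 (Primrec.nat_add.comp h2 (Primrec.nat_mul.comp (Primrec.const 2) hx))
  · exact c 1 hT
  · exact c 1 hT
  · exact c 1 hT
  · exact Primrec.nat_mul.comp (Primrec.const 2) h2
  · exact c 1 hT
  · exact c 1 hT
  · exact c 1 hT
  · exact c 1 hT

theorem primrec_startDen : Primrec startDen := by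
  have h2 : Primrec fun x : ℕ => x ^ 2 :=
    (Primrec.nat_mul.comp Primrec.id Primrec.id).of_eq fun x => (sq x).symm
  exact Primrec.nat_mul.comp (Primrec.const 12)
    (Primrec.nat_add.comp (Primrec.nat_add.comp h2 Primrec.id) (Primrec.const 1))

theorem primrec_codeOfRules (L : List AffineRule) : Primrec (codeOfRules L) := by
  -- The matrices and accepting states do not depend on `x`; only the starting distribution has to
  -- be computed.
  refine Primrec.pair ?_ (Primrec.const _)
  rw [Primrec.fin_curry]
  exact Primrec.pair (Primrec.fin_app.comp (primrec_startNum.comp Primrec.fst) Primrec.snd)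
    (primrec_startDen.comp Primrec.fst)

end PFA

theorem mainTheorem4 : ¬ PFA.EmptinessDecidable 12 (1 / 4) := by
  rintro ⟨P, hP, h⟩
  obtain ⟨L, x₀, hx₀, hL⟩ := AffineRule.exists_halting_rules
  refine ComputablePred.halting_problem 0 ?_
  have hf : Computable fun c : Nat.Partrec.Code => PFA.codeOfRules L (x₀ (Encodable.encode c)) :=
    ((PFA.primrec_codeOfRules L).comp (hx₀.comp Primrec.encode)).to_comp
  have h1 := (ComputablePred.computable_of_manyOneReducible
    (p := fun c : Nat.Partrec.Code => P (PFA.codeOfRules L (x₀ (Encodable.encode c))))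
    ⟨_, hf, fun _ => Iff.rfl⟩ hP).not
  -- The language is non-empty exactly when the program halts, so the complement of the decided
  -- predicate is the halting predicate.
  refine h1.of_eq fun c => ?_
  rw [h _ _ _ (PFA.represents_codeOfRules L _), ← not_exists, not_not,
    PFA.exists_mem_language_ofRules, ← hL, Denumerable.ofNat_encode]
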